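/- Let $k$ be an algebraically closed field of characteristic $0$. For $\lambda_1,\lambda_2,\alpha\in k$, where $\alpha=0$ if $\lambda_1\neq\lambda_2$ and $\alpha\in\{0,1\}$ if $\lambda_1=\lambda_2$, let $A(\lambda_1,\lambda_2,\alpha)$ be the $k$-algebra generated by $X,Y,Z$ subject to the relations $$[X,Y]=0,\qquad [Z,X]=\lambda_1X+\alpha Y,\qquad [Z,Y]=\lambda_2Y$$ (with $[u,v]=uv-vu$), made into a Hopf algebra by $$\Delta(X)=1\otimes X+X\otimes 1,\quad \Delta(Y)=1\otimes Y+Y\otimes 1,\quad \Delta(Z)=1\otimes Z+X\otimes Y+Z\otimes 1,$$ $$\varepsilon(X)=\varepsilon(Y)=\varepsilon(Z)=0,\qquad S(X)=-X,\quad S(Y)=-Y,\quad S(Z)=-Z+XY.$$ Then: (1) for every $\lambda\in k$, the four Hopf algebras $A(0,0,0)$, $A(0,0,1)$, $A(1,1,1)$ and $A(1,\lambda,0)$ are pairwise non-isomorphic as Hopf algebras; (2) for all $\lambda,\gamma\in k$, $A(1,\lambda,0)\cong A(1,\gamma,0)$ as Hopf algebras if and only if $\lambda=\gamma$ or $\lambda\gamma=1$.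 -/

import Mathlib

open scoped TensorProduct

noncomputable section

namespace ConnHopf

/-- The labels of the three algebra generators. -/
inductive Gen : Type
  | X | Y | Z

variable {k : Type*} [Field k]

/-- The defining relations `[X, Y] = 0`, `[Z, X] = l₁ X + α Y`, `[Z, Y] = l₂ Y`,
with `[u, v] = u v - v u`. -/
inductive Rel (l₁ l₂ α : k) : FreeAlgebra k Gen → FreeAlgebra k Gen → Prop
  | XY : Rel l₁ l₂ α
      (FreeAlgebra.ι k Gen.X * FreeAlgebra.ι k Gen.Y
        - FreeAlgebra.ι k Gen.Y * FreeAlgebra.ι k Gen.X) 0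
  | ZX : Rel l₁ l₂ α
      (FreeAlgebra.ι k Gen.Z * FreeAlgebra.ι k Gen.X
        - FreeAlgebra.ι k Gen.X * FreeAlgebra.ι k Gen.Z)
      (l₁ • FreeAlgebra.ι k Gen.X + α • FreeAlgebra.ι k Gen.Y)
  | ZY : Rel l₁ l₂ α
      (FreeAlgebra.ι k Gen.Z * FreeAlgebra.ι k Gen.Y
        - FreeAlgebra.ι k Gen.Y * FreeAlgebra.ι k Gen.Z)
      (l₂ • FreeAlgebra.ι k Gen.Y)

/-- The algebra `A(l₁, l₂, α)`: the free algebra on `X, Y, Z` modulo the relations `Rel`. The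
Hopf structure below exists for all values of the parameters. -/
def A (l₁ l₂ α : k) : Type _ := RingQuot (Rel l₁ l₂ α)

variable (l₁ l₂ α : k)

instance : Ring (A l₁ l₂ α) := inferInstanceAs (Ring (RingQuot (Rel l₁ l₂ α)))

instance : Algebra k (A l₁ l₂ α) := inferInstanceAs (Algebra k (RingQuot (Rel l₁ l₂ α)))

namespace A

/-- The quotient map from the free algebra. -/
def mk : FreeAlgebra k Gen →ₐ[k] A l₁ l₂ α := RingQuot.mkAlgHom k (Rel l₁ l₂ α)

theorem mk_rel {x y : FreeAlgebra k Gen} (h : Rel l₁ l₂ α x y) :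
    mk l₁ l₂ α x = mk l₁ l₂ α y :=
  RingQuot.mkAlgHom_rel k h

/-- The generators of `A(l₁, l₂, α)`. -/
def gen (g : Gen) : A l₁ l₂ α := mk l₁ l₂ α (FreeAlgebra.ι k g)

/-- The generator `X`. -/
abbrev X : A l₁ l₂ α := gen l₁ l₂ α Gen.X
/-- The generator `Y`. -/
abbrev Y : A l₁ l₂ α := gen l₁ l₂ α Gen.Y
/-- The generator `Z`. -/
abbrev Z : A l₁ l₂ α := gen l₁ l₂ α Gen.Z

@[simp] theorem mk_ι (g : Gen) : mk l₁ l₂ α (FreeAlgebra.ι k g) = gen l₁ l₂ α g := rfl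

theorem rel_XY : X l₁ l₂ α * Y l₁ l₂ α - Y l₁ l₂ α * X l₁ l₂ α = 0 := by
  simpa using mk_rel l₁ l₂ α Rel.XY

theorem rel_ZX : Z l₁ l₂ α * X l₁ l₂ α - X l₁ l₂ α * Z l₁ l₂ α
    = l₁ • X l₁ l₂ α + α • Y l₁ l₂ α := by
  simpa using mk_rel l₁ l₂ α Rel.ZX

theorem rel_ZY : Z l₁ l₂ α * Y l₁ l₂ α - Y l₁ l₂ α * Z l₁ l₂ α = l₂ • Y l₁ l₂ α := by
  simpa using mk_rel l₁ l₂ α Rel.ZY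

variable {l₁ l₂ α}

/-- The algebra map out of `A(l₁, l₂, α)` determined by images of the generators that satisfy
the defining relations. -/
def lift {B : Type*} [Ring B] [Algebra k B] (f : Gen → B)
    (hXY : f Gen.X * f Gen.Y - f Gen.Y * f Gen.X = 0)
    (hZX : f Gen.Z * f Gen.X - f Gen.X * f Gen.Z = l₁ • f Gen.X + α • f Gen.Y)
    (hZY : f Gen.Z * f Gen.Y - f Gen.Y * f Gen.Z = l₂ • f Gen.Y) :
    A l₁ l₂ α →ₐ[k] B :=
  RingQuot.liftAlgHom k ⟨FreeAlgebra.lift k f, by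
    rintro _ _ (_ | _ | _)
    · simpa using hXY
    · simpa using hZX
    · simpa using hZY⟩

@[simp] theorem lift_gen {B : Type*} [Ring B] [Algebra k B] (f : Gen → B) (hXY hZX hZY) (g : Gen) :
    lift (l₁ := l₁) (l₂ := l₂) (α := α) f hXY hZX hZY (gen l₁ l₂ α g) = f g := by
  have h := RingQuot.liftAlgHom_mkAlgHom_apply (S := k) (FreeAlgebra.lift k f)
    (s := Rel l₁ l₂ α) (by
      rintro _ _ (_ | _ | _)
      · simpa using hXY
      · simpa using hZX
      · simpa using hZY) (FreeAlgebra.ι k g)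
  exact h.trans (FreeAlgebra.lift_ι_apply f g)

@[ext] theorem algHom_ext {B : Type*} [Semiring B] [Algebra k B] {f g : A l₁ l₂ α →ₐ[k] B}
    (hX : f (X l₁ l₂ α) = g (X l₁ l₂ α)) (hY : f (Y l₁ l₂ α) = g (Y l₁ l₂ α))
    (hZ : f (Z l₁ l₂ α) = g (Z l₁ l₂ α)) : f = g := by
  refine RingQuot.ringQuot_ext' (S := k) f g ?_
  ext i
  cases i
  exacts [hX, hY, hZ]

theorem induction {p : A l₁ l₂ α → Prop} (hc : ∀ r : k, p (algebraMap k _ r))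
    (hg : ∀ g, p (gen l₁ l₂ α g)) (hmul : ∀ a b, p a → p b → p (a * b))
    (hadd : ∀ a b, p a → p b → p (a + b)) (a : A l₁ l₂ α) : p a := by
  obtain ⟨a, rfl⟩ : ∃ b, mk l₁ l₂ α b = a := RingQuot.mkAlgHom_surjective k _ a
  induction a using FreeAlgebra.induction with
  | grade0 r => simpa using hc r
  | grade1 g => exact hg g
  | mul a b ha hb => rw [map_mul]; exact hmul _ _ ha hb
  | add a b ha hb => rw [map_add]; exact hadd _ _ ha hb

variable (l₁ l₂ α)

/-- Images of the generators under the comultiplication: `X` and `Y` are primitive and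
`Δ Z = 1 ⊗ Z + X ⊗ Y + Z ⊗ 1`. -/
def comulGen : Gen → A l₁ l₂ α ⊗[k] A l₁ l₂ α
  | .X => 1 ⊗ₜ X l₁ l₂ α + X l₁ l₂ α ⊗ₜ 1
  | .Y => 1 ⊗ₜ Y l₁ l₂ α + Y l₁ l₂ α ⊗ₜ 1
  | .Z => 1 ⊗ₜ Z l₁ l₂ α + X l₁ l₂ α ⊗ₜ Y l₁ l₂ α + Z l₁ l₂ α ⊗ₜ 1

/-- The comultiplication as an algebra map. -/
def comulHom : A l₁ l₂ α →ₐ[k] A l₁ l₂ α ⊗[k] A l₁ l₂ α :=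
  lift (comulGen l₁ l₂ α)
    (by
      have h := sub_eq_zero.mp (rel_XY l₁ l₂ α)
      simp only [comulGen, mul_add, add_mul, Algebra.TensorProduct.tmul_mul_tmul, one_mul, mul_one,
        h]
      abel)
    (by
      have h := sub_eq_zero.mp (rel_XY l₁ l₂ α)
      have h' := sub_eq_iff_eq_add.mp (rel_ZX l₁ l₂ α)
      simp only [comulGen, mul_add, add_mul, Algebra.TensorProduct.tmul_mul_tmul, one_mul, mul_one,
        h, h', TensorProduct.tmul_add, TensorProduct.add_tmul, TensorProduct.tmul_smul,
        TensorProduct.smul_tmul', smul_add]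
      abel)
    (by
      have h := sub_eq_zero.mp (rel_XY l₁ l₂ α)
      have h' := sub_eq_iff_eq_add.mp (rel_ZY l₁ l₂ α)
      simp only [comulGen, mul_add, add_mul, Algebra.TensorProduct.tmul_mul_tmul, one_mul, mul_one,
        h, h', TensorProduct.tmul_add, TensorProduct.add_tmul, TensorProduct.tmul_smul,
        TensorProduct.smul_tmul', smul_add]
      abel)

/-- The counit as an algebra map: all three generators go to `0`. -/
def counitHom : A l₁ l₂ α →ₐ[k] k :=
  lift (fun _ => 0) (by simp) (by simp) (by simp)

instance : Bialgebra k (A l₁ l₂ α) :=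
  Bialgebra.ofAlgHom (comulHom l₁ l₂ α) (counitHom l₁ l₂ α)
    (by
      ext <;> simp [comulHom, comulGen, TensorProduct.tmul_add, TensorProduct.add_tmul,
        Algebra.TensorProduct.one_def] <;> abel)
    (by
      ext <;> simp [comulHom, comulGen, counitHom])
    (by
      ext <;> simp [comulHom, comulGen, counitHom])

/-- Images of the generators under the antipode: `S X = -X`, `S Y = -Y`, `S Z = -Z + X Y`. -/
def antipodeGen : Gen → A l₁ l₂ α
  | .X => -X l₁ l₂ α
  | .Y => -Y l₁ l₂ α
  | .Z => -Z l₁ l₂ α + X l₁ l₂ α * Y l₁ l₂ α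

/-- The antipode as an algebra map to the opposite algebra. -/
def antipodeHom : A l₁ l₂ α →ₐ[k] (A l₁ l₂ α)ᵐᵒᵖ :=
  lift (fun g => MulOpposite.op (antipodeGen l₁ l₂ α g))
    (by
      apply MulOpposite.unop_injective
      have h := sub_eq_zero.mp (rel_XY l₁ l₂ α)
      simp [antipodeGen, h])
    (by
      apply MulOpposite.unop_injective
      have h := sub_eq_zero.mp (rel_XY l₁ l₂ α)
      have h' := sub_eq_iff_eq_add.mp (rel_ZX l₁ l₂ α)
      have e : X l₁ l₂ α * Y l₁ l₂ α * X l₁ l₂ α = X l₁ l₂ α * (X l₁ l₂ α * Y l₁ l₂ α) := by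
        rw [mul_assoc, h]
      simp [antipodeGen, mul_add, add_mul, h', e]
      abel)
    (by
      apply MulOpposite.unop_injective
      have h := sub_eq_zero.mp (rel_XY l₁ l₂ α)
      have h' := sub_eq_iff_eq_add.mp (rel_ZY l₁ l₂ α)
      have e : X l₁ l₂ α * Y l₁ l₂ α * Y l₁ l₂ α = Y l₁ l₂ α * (X l₁ l₂ α * Y l₁ l₂ α) := by
        rw [← mul_assoc, h]
      simp [antipodeGen, mul_add, add_mul, h', e]
      abel)

/-- The antipode as a linear endomorphism. -/
def antipodeLin : A l₁ l₂ α →ₗ[k] A l₁ l₂ α :=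
  (MulOpposite.opLinearEquiv k).symm.toLinearMap ∘ₗ (antipodeHom l₁ l₂ α).toLinearMap

theorem antipodeLin_mul (a b : A l₁ l₂ α) :
    antipodeLin l₁ l₂ α (a * b) = antipodeLin l₁ l₂ α b * antipodeLin l₁ l₂ α a := by
  simp [antipodeLin]

theorem antipodeLin_algebraMap (r : k) :
    antipodeLin l₁ l₂ α (algebraMap k _ r) = algebraMap k _ r := by
  simp [antipodeLin, MulOpposite.algebraMap_apply]

theorem antipodeLin_one : antipodeLin l₁ l₂ α 1 = 1 := by
  simp [antipodeLin]

theorem antipodeLin_gen (g : Gen) :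
    antipodeLin l₁ l₂ α (gen l₁ l₂ α g) = antipodeGen l₁ l₂ α g := by
  simp [antipodeLin, antipodeHom]

theorem comul_gen (g : Gen) :
    Coalgebra.comul (R := k) (gen l₁ l₂ α g) = comulGen l₁ l₂ α g := by
  change comulHom l₁ l₂ α _ = _
  simp [comulHom]

theorem counit_gen (g : Gen) : Coalgebra.counit (R := k) (gen l₁ l₂ α g) = 0 := by
  change counitHom l₁ l₂ α _ = _
  simp [counitHom]

theorem antipode_left (a : A l₁ l₂ α) :
    LinearMap.mul' k _ ((antipodeLin l₁ l₂ α).rTensor _ (Coalgebra.comul (R := k) a))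
      = algebraMap k _ (Coalgebra.counit (R := k) a) := by
  induction a using A.induction with
  | hc r => simp [Algebra.TensorProduct.algebraMap_apply, antipodeLin_algebraMap]
  | hg g =>
    cases g <;> simp [comul_gen, counit_gen, comulGen, antipodeLin_gen, antipodeGen,
      antipodeLin_one, ← add_assoc]
  | hadd a b ha hb => simp only [map_add, ha, hb]
  | hmul a b ha hb =>
    have key : ∀ u v : A l₁ l₂ α ⊗[k] A l₁ l₂ α, ∀ c : k,
        LinearMap.mul' k _ ((antipodeLin l₁ l₂ α).rTensor _ u) = algebraMap k _ c →
        LinearMap.mul' k _ ((antipodeLin l₁ l₂ α).rTensor _ (u * v))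
          = algebraMap k _ c * LinearMap.mul' k _ ((antipodeLin l₁ l₂ α).rTensor _ v) := by
      intro u v c hu
      induction v with
      | zero => simp
      | add v w hv hw => simp only [mul_add, map_add, hv, hw]
      | tmul x y =>
        have h : LinearMap.mul' k _ ((antipodeLin l₁ l₂ α).rTensor _ (u * x ⊗ₜ y))
            = antipodeLin l₁ l₂ α x
              * LinearMap.mul' k _ ((antipodeLin l₁ l₂ α).rTensor _ u) * y := by
          clear hu
          induction u with
          | zero => simp
          | add v w hv hw => simp only [mul_add, add_mul, map_add, hv, hw]
          | tmul p q => simp [antipodeLin_mul, mul_assoc]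
        rw [h, hu, ← Algebra.commutes]
        simp [mul_assoc]
    rw [Bialgebra.comul_mul, key _ _ _ ha, hb, Bialgebra.counit_mul, map_mul]

theorem antipode_right (a : A l₁ l₂ α) :
    LinearMap.mul' k _ ((antipodeLin l₁ l₂ α).lTensor _ (Coalgebra.comul (R := k) a))
      = algebraMap k _ (Coalgebra.counit (R := k) a) := by
  induction a using A.induction with
  | hc r => simp [Algebra.TensorProduct.algebraMap_apply, antipodeLin]
  | hg g =>
    cases g <;> simp [comul_gen, counit_gen, comulGen, antipodeLin_gen, antipodeGen,
      antipodeLin_one]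
  | hadd a b ha hb => simp only [map_add, ha, hb]
  | hmul a b ha hb =>
    have key : ∀ u v : A l₁ l₂ α ⊗[k] A l₁ l₂ α, ∀ c : k,
        LinearMap.mul' k _ ((antipodeLin l₁ l₂ α).lTensor _ v) = algebraMap k _ c →
        LinearMap.mul' k _ ((antipodeLin l₁ l₂ α).lTensor _ (u * v))
          = LinearMap.mul' k _ ((antipodeLin l₁ l₂ α).lTensor _ u) * algebraMap k _ c := by
      intro u v c hv
      induction u with
      | zero => simp
      | add v w hv hw => simp only [add_mul, map_add, hv, hw]
      | tmul x y =>
        have h : LinearMap.mul' k _ ((antipodeLin l₁ l₂ α).lTensor _ (x ⊗ₜ y * v))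
            = x * LinearMap.mul' k _ ((antipodeLin l₁ l₂ α).lTensor _ v)
              * antipodeLin l₁ l₂ α y := by
          clear hv
          induction v with
          | zero => simp
          | add v w hv hw => simp only [mul_add, add_mul, map_add, hv, hw]
          | tmul p q => simp [antipodeLin_mul, mul_assoc]
        rw [h, hv, mul_assoc, Algebra.commutes]
        simp [mul_assoc]
    rw [Bialgebra.comul_mul, key _ _ _ hb, ha, Bialgebra.counit_mul, map_mul]

instance : HopfAlgebra k (A l₁ l₂ α) where
  antipode := antipodeLin l₁ l₂ α
  mul_antipode_rTensor_comul := LinearMap.ext (antipode_left l₁ l₂ α)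
  mul_antipode_lTensor_comul := LinearMap.ext (antipode_right l₁ l₂ α)

end A

end ConnHopf

/-- Two Hopf algebras are isomorphic if there is a bijective linear map between them that respects
multiplication, unit, comultiplication and counit; such a map automatically commutes with the
antipodes. -/
def HopfIso (k H K : Type*) [Field k] [Ring H] [Ring K] [HopfAlgebra k H] [HopfAlgebra k K] :
    Prop :=
  Nonempty (H ≃ₐc[k] K)

end

/-!
To a character `χ` of a bialgebra `H` one attaches the space `twistedDer χ` of linear forms `D` with
`D (a b) = χ a * D b + D a * ε b`. An isomorphism of bialgebras permutes the characters, fixes `ε`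
and preserves the dimension of `twistedDer χ` (`finrank_twistedDer_comp`), so the dimension as a
function of `χ` is an invariant.

For `A(l₁, l₂, α)`, a twisted derivation is the off-diagonal entry of an upper triangular `2 × 2`
representation with diagonal `(χ, ε)`. Hence `twistedDer χ` is the solution space of a linear system
of three equations for the values on `X`, `Y`, `Z` (`mem_range_derValues`), and no basis of
`A(l₁, l₂, α)` is needed. At the character `X, Y ↦ 0`, `Z ↦ z` the system reads
`(z - l₁) D X = α D Y`, `(z - l₂) D Y = 0`, with `D Z` free, so that the eigenvalues of `ad Z` on
`⟨X, Y⟩` are visible in the jumps of the dimension: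

* at `ε` the dimension is `3` for `A(0, 0, 0)`, `2` for `A(0, 0, 1)`, `1` for `A(1, 1, 1)`, and `1`
  or `2` for `A(1, l, 0)` according to whether `l ≠ 0` or `l = 0`;
* `A(0, 0, 1)` has dimension at most `1` at every other character, whereas `A(1, 0, 0)` has
  dimension `2` at `z = 1`;
* along the line of characters `z`, the dimension is `1 + [z = 1] + [z = l]` for `A(1, l, 0)` and
  `1 + [z = 1]` for `A(1, 1, 1)`.

When `l₁` and `l₂` are nonzero the line contains all characters. An isomorphism acts on it by a
polynomial map with polynomial inverse that fixes `0`, thus by a scaling `z ↦ c z`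
(`exists_zChar_comp_eq`). Comparing the jumps, `c` carries the multiset `{1, g}` to `{1, l}`, which
leaves only `l = g` and `l g = 1`.

Conversely, if `l g = 1`, then `X ↦ Y`, `Y ↦ -l X`, `Z ↦ -l (X Y - Z)` is an isomorphism
`A(1, l, 0) ≅ A(1, g, 0)` (`hopfIso_swap`).
-/

noncomputable section

namespace ConnHopf

open Module Polynomial

/-! ### Twisted derivations of an augmented algebra -/

/-- For a character `χ` of a bialgebra `H` with counit `ε`, the space of linear forms `D` with
`D (a b) = χ a * D b + D a * ε b`; equivalently, the `2 × 2` upper triangular representations of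
`H` with diagonal `(χ, ε)`. -/
def twistedDer {k H : Type*} [Field k] [Ring H] [Bialgebra k H] (χ : H →ₐ[k] k) :
    Submodule k (Dual k H) where
  carrier := {D | ∀ a b, D (a * b) = χ a * D b + D a * Coalgebra.counit (R := k) b}
  add_mem' := by
    intro D E hD hE a b
    simp only [LinearMap.add_apply, hD a b, hE a b]
    ring
  zero_mem' := by simp
  smul_mem' := by
    intro c D hD a b
    simp only [LinearMap.smul_apply, hD a b, smul_eq_mul]
    ring

theorem mem_twistedDer {k H : Type*} [Field k] [Ring H] [Bialgebra k H] {χ : H →ₐ[k] k}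
    {D : Dual k H} :
    D ∈ twistedDer χ ↔
      ∀ a b, D (a * b) = χ a * D b + D a * Coalgebra.counit (R := k) b :=
  Iff.rfl

theorem comp_mem_twistedDer {k H K : Type*} [Field k] [Ring H] [Ring K] [Bialgebra k H]
    [Bialgebra k K] (e : H ≃ₐc[k] K) {χ : K →ₐ[k] k} {D : Dual k K} (hD : D ∈ twistedDer χ) :
    D ∘ₗ (e : H →ₐ[k] K).toLinearMap ∈ twistedDer (χ.comp (e : H →ₐ[k] K)) := by
  intro a b
  have h := hD (e a) (e b)
  rw [CoalgHomClass.counit_comp_apply, ← map_mul] at h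
  exact h

/-- Pulling back along an isomorphism of bialgebras preserves the dimension of the space of
twisted derivations. -/
theorem finrank_twistedDer_comp {k H K : Type*} [Field k] [Ring H] [Ring K] [Bialgebra k H]
    [Bialgebra k K] (e : H ≃ₐc[k] K) (χ : K →ₐ[k] k) :
    finrank k (twistedDer (χ.comp (e : H →ₐ[k] K))) = finrank k (twistedDer χ) := by
  refine LinearEquiv.finrank_eq
    { toFun := fun D => ⟨D.1 ∘ₗ (e.symm : K →ₐ[k] H).toLinearMap, ?_⟩
      invFun := fun D => ⟨D.1 ∘ₗ (e : H →ₐ[k] K).toLinearMap, comp_mem_twistedDer e D.2⟩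
      map_add' := fun _ _ => rfl
      map_smul' := fun _ _ => rfl
      left_inv := fun D => ?_
      right_inv := fun D => ?_ }
  · have h := comp_mem_twistedDer e.symm D.2
    have hχ : (χ.comp (e : H →ₐ[k] K)).comp (e.symm : K →ₐ[k] H) = χ := by
      ext a
      exact congrArg χ (e.apply_symm_apply a)
    rwa [hχ] at h
  · ext a
    exact congrArg D.1 (e.symm_apply_apply a)
  · ext a
    exact congrArg D.1 (e.apply_symm_apply a)

/-! ### Twisted derivations of `A(l₁, l₂, α)` -/

instance : DecidableEq Gen := fun a b => by
  cases a <;> cases b <;> first | exact isTrue rfl | exact isFalse (by simp)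

instance : Fintype Gen := ⟨{.X, .Y, .Z}, by rintro (_ | _ | _) <;> simp⟩

variable {k : Type*} [Field k] {l₁ l₂ α : k}

theorem A.relations_of_char (χ : A l₁ l₂ α →ₐ[k] k) :
    l₁ * χ (A.X l₁ l₂ α) + α * χ (A.Y l₁ l₂ α) = 0 ∧ l₂ * χ (A.Y l₁ l₂ α) = 0 := by
  have h₁ := congrArg χ (A.rel_ZX l₁ l₂ α)
  have h₂ := congrArg χ (A.rel_ZY l₁ l₂ α)
  simp only [map_sub, map_mul, map_add, map_smul, smul_eq_mul] at h₁ h₂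
  constructor
  · rw [← h₁]; ring
  · rw [← h₂]; ring

/-- The linear system that the values `v` of a `χ`-twisted derivation on the generators satisfy,
one equation for each defining relation. -/
def IsDerValues (χ : A l₁ l₂ α →ₐ[k] k) (v : Gen → k) : Prop :=
  χ (A.X l₁ l₂ α) * v .Y = χ (A.Y l₁ l₂ α) * v .X ∧
  χ (A.Z l₁ l₂ α) * v .X - χ (A.X l₁ l₂ α) * v .Z = l₁ * v .X + α * v .Y ∧
  χ (A.Z l₁ l₂ α) * v .Y - χ (A.Y l₁ l₂ α) * v .Z = l₂ * v .Y

/-- The values of a twisted derivation on the generators. -/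
def derValues (χ : A l₁ l₂ α →ₐ[k] k) : twistedDer χ →ₗ[k] (Gen → k) where
  toFun D g := D.1 (A.gen l₁ l₂ α g)
  map_add' _ _ := rfl
  map_smul' _ _ := rfl

theorem derValues_injective (χ : A l₁ l₂ α →ₐ[k] k) : Function.Injective (derValues χ) := by
  rintro ⟨D, hD⟩ ⟨E, hE⟩ h
  have hD1 : D 1 = 0 := by simpa using hD 1 1
  have hE1 : E 1 = 0 := by simpa using hE 1 1
  ext a
  change D a = E a
  induction a using A.induction with
  | hc r => rw [Algebra.algebraMap_eq_smul_one, map_smul, map_smul, hD1, hE1]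
  | hg g => exact congrFun h g
  | hmul a b ha hb => rw [hD, hE, ha, hb]
  | hadd a b ha hb => rw [map_add, map_add, ha, hb]

theorem exists_derValues_eq (χ : A l₁ l₂ α →ₐ[k] k) {v : Gen → k} (hv : IsDerValues χ v) :
    ∃ D, derValues χ D = v := by
  obtain ⟨hXY, hZX, hZY⟩ := hv
  obtain ⟨h₁, h₂⟩ := A.relations_of_char χ
  -- The triangular representation with diagonal `(χ, ε)` and off-diagonal entries `v`.
  let M : A l₁ l₂ α →ₐ[k] Matrix (Fin 2) (Fin 2) k :=
    A.lift (fun g => !![χ (A.gen l₁ l₂ α g), v g; 0, 0])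
      (by
        ext i j
        fin_cases i <;> fin_cases j <;> simp [hXY, mul_comm])
      (by
        ext i j
        fin_cases i <;> fin_cases j <;> simp [h₁, ← hZX, mul_comm (v _)]
        ring)
      (by
        ext i j
        fin_cases i <;> fin_cases j <;> simp [h₂, ← hZY, mul_comm (v _)]
        ring)
  have hM : ∀ a, M a 0 0 = χ a ∧ M a 1 0 = 0 ∧ M a 1 1 = Coalgebra.counit (R := k) a := by
    intro a
    induction a using A.induction with
    | hc r => simp [Matrix.algebraMap_matrix_apply]
    | hg g => simp [M, A.counit_gen]
    | hmul a b ha hb =>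
      simp [Matrix.mul_apply, Fin.sum_univ_two, ha, hb]
    | hadd a b ha hb => simp [ha, hb]
  refine ⟨⟨(Matrix.entryLinearMap k k 0 1) ∘ₗ M.toLinearMap, fun a b => ?_⟩, ?_⟩
  · simp [Matrix.mul_apply, Fin.sum_univ_two, hM]
  · ext g
    simp [derValues, M]

theorem isDerValues_derValues (χ : A l₁ l₂ α →ₐ[k] k) (D : twistedDer χ) :
    IsDerValues χ (derValues χ D) := by
  obtain ⟨D, hD⟩ := D
  rw [mem_twistedDer] at hD
  have h₀ := congrArg D (A.rel_XY l₁ l₂ α)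
  have h₁ := congrArg D (A.rel_ZX l₁ l₂ α)
  have h₂ := congrArg D (A.rel_ZY l₁ l₂ α)
  simp only [map_sub, hD, A.counit_gen, map_add, map_smul, smul_eq_mul, mul_zero, add_zero,
    map_zero, sub_eq_zero] at h₀ h₁ h₂
  exact ⟨h₀, h₁, h₂⟩

theorem mem_range_derValues {χ : A l₁ l₂ α →ₐ[k] k} {v : Gen → k} :
    v ∈ LinearMap.range (derValues χ) ↔ IsDerValues χ v :=
  ⟨by rintro ⟨D, rfl⟩; exact isDerValues_derValues χ D, exists_derValues_eq χ⟩

theorem finrank_twistedDer (χ : A l₁ l₂ α →ₐ[k] k) :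
    finrank k (twistedDer χ) = finrank k (LinearMap.range (derValues χ)) :=
  (LinearMap.finrank_range_of_inj (derValues_injective χ)).symm

/-- If the linear system for the values on the generators just says that the coordinates in `J`
vanish, then the space of twisted derivations has dimension `3 - #J`. -/
theorem finrank_twistedDer_of_coord (χ : A l₁ l₂ α →ₐ[k] k) (J : Finset Gen)
    (h : ∀ v : Gen → k, IsDerValues χ v ↔ ∀ g ∈ J, v g = 0) :
    finrank k (twistedDer χ) = Jᶜ.card := by
  have hR : LinearMap.range (derValues χ)
      = ⨅ i ∈ (J : Set Gen), LinearMap.ker (LinearMap.proj i : (Gen → k) →ₗ[k] k) := by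
    ext v
    rw [mem_range_derValues, h]
    simp
  rw [finrank_twistedDer, hR, (LinearMap.iInfKerProjEquiv k (fun _ : Gen => k)
    (I := ((Jᶜ : Finset Gen) : Set Gen)) (J := J)
    (by simpa using disjoint_compl_left) (by simp)).finrank_eq]
  simp [Finset.card_compl]

/-! ### The characters that vanish on `X` and `Y` -/

variable (l₁ l₂ α) in
/-- The quotient map `A(l₁, l₂, α) → k[T]` killing `X` and `Y` and sending `Z` to `T`. -/
def toPoly : A l₁ l₂ α →ₐ[k] k[X] :=
  A.lift (fun | .X => 0 | .Y => 0 | .Z => Polynomial.X) (by simp) (by simp) (by simp)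

variable (l₁ l₂ α) in
/-- The character with `X, Y ↦ 0` and `Z ↦ z`. -/
def zChar (z : k) : A l₁ l₂ α →ₐ[k] k := (aeval z).comp (toPoly l₁ l₂ α)

@[simp] theorem zChar_X (z : k) : zChar l₁ l₂ α z (A.X l₁ l₂ α) = 0 := by simp [zChar, toPoly]
@[simp] theorem zChar_Y (z : k) : zChar l₁ l₂ α z (A.Y l₁ l₂ α) = 0 := by simp [zChar, toPoly]
@[simp] theorem zChar_Z (z : k) : zChar l₁ l₂ α z (A.Z l₁ l₂ α) = z := by simp [zChar, toPoly]

theorem zChar_zero_apply (a : A l₁ l₂ α) :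
    zChar l₁ l₂ α 0 a = Coalgebra.counit (R := k) a := by
  have h : zChar l₁ l₂ α 0 = Bialgebra.counitAlgHom k (A l₁ l₂ α) := by
    ext <;> simp [A.counit_gen]
  exact DFunLike.congr_fun h a

theorem zChar_zero_comp {m₁ m₂ β : k} (e : A l₁ l₂ α ≃ₐc[k] A m₁ m₂ β) :
    (zChar m₁ m₂ β 0).comp (e : A l₁ l₂ α →ₐ[k] A m₁ m₂ β) = zChar l₁ l₂ α 0 := by
  refine AlgHom.ext fun a => ?_
  refine (zChar_zero_apply _).trans ?_
  rw [zChar_zero_apply]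
  exact CoalgHomClass.counit_comp_apply e a

/-- When `l₁` and `l₂` are nonzero, `X` and `Y` lie in the commutator ideal, so every character
kills them. -/
theorem eq_zChar (h₁ : l₁ ≠ 0) (h₂ : l₂ ≠ 0) (χ : A l₁ l₂ α →ₐ[k] k) :
    χ = zChar l₁ l₂ α (χ (A.Z l₁ l₂ α)) := by
  obtain ⟨hX, hY⟩ := A.relations_of_char χ
  have hY' : χ (A.Y l₁ l₂ α) = 0 := by simpa [h₂] using hY
  have hX' : χ (A.X l₁ l₂ α) = 0 := by simpa [h₁, hY'] using hX
  ext <;> simp [hX', hY']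

/-- An isomorphism between algebras with nonzero parameters acts on the line of characters
`zChar z` by a polynomial map with polynomial inverse fixing `0`, that is, by a scaling. -/
theorem exists_zChar_comp_eq [Infinite k] {m₁ m₂ β : k} (h₁ : l₁ ≠ 0) (h₂ : l₂ ≠ 0)
    (h₃ : m₁ ≠ 0) (h₄ : m₂ ≠ 0) (e : A l₁ l₂ α ≃ₐc[k] A m₁ m₂ β) :
    ∃ c : k, c ≠ 0 ∧ ∀ z, (zChar m₁ m₂ β z).comp (e : A l₁ l₂ α →ₐ[k] A m₁ m₂ β)
      = zChar l₁ l₂ α (c * z) := by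
  let P : k[X] := toPoly m₁ m₂ β (e (A.Z l₁ l₂ α))
  let Q : k[X] := toPoly l₁ l₂ α (e.symm (A.Z m₁ m₂ β))
  have hP : ∀ z, (zChar m₁ m₂ β z).comp (e : A l₁ l₂ α →ₐ[k] A m₁ m₂ β)
      = zChar l₁ l₂ α (P.eval z) := by
    intro z
    rw [eq_zChar h₁ h₂ ((zChar m₁ m₂ β z).comp _)]
    congr 1
  have hQ : ∀ z, (zChar l₁ l₂ α z).comp (e.symm : A m₁ m₂ β →ₐ[k] A l₁ l₂ α)
      = zChar m₁ m₂ β (Q.eval z) := by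
    intro z
    rw [eq_zChar h₃ h₄ ((zChar l₁ l₂ α z).comp _)]
    congr 1
  have hcomp : P.comp Q = Polynomial.X := by
    refine Polynomial.funext fun z => ?_
    rw [eval_comp, eval_X]
    have h := DFunLike.congr_fun (hP (Q.eval z)) (A.Z l₁ l₂ α)
    rw [← hQ, zChar_Z] at h
    rw [← h]
    change zChar l₁ l₂ α z (e.symm (e _)) = z
    rw [e.symm_apply_apply, zChar_Z]
  have hdeg : P.natDegree = 1 := by
    have h := congrArg natDegree hcomp
    rw [natDegree_comp, natDegree_X] at h
    exact Nat.eq_one_of_mul_eq_one_right h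
  have h0 : P.eval 0 = 0 := by
    have h := DFunLike.congr_fun ((hP 0).symm.trans (zChar_zero_comp e)) (A.Z l₁ l₂ α)
    simpa using h
  obtain ⟨a, b, hab⟩ := exists_eq_X_add_C_of_natDegree_le_one hdeg.le
  have hb : b = 0 := by simpa [hab] using h0
  refine ⟨a, ?_, fun z => ?_⟩
  · rintro rfl
    simp [hab] at hdeg
  · rw [hP, hab, hb]
    simp

/-! ### Dimensions of the spaces of twisted derivations -/

theorem isDerValues_zChar {z : k} {v : Gen → k} :
    IsDerValues (zChar l₁ l₂ α z) v ↔ z * v .X = l₁ * v .X + α * v .Y ∧ z * v .Y = l₂ * v .Y := by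
  simp [IsDerValues]

open Classical in
theorem finrank_twistedDer_diag (l z : k) :
    finrank k (twistedDer (zChar 1 l 0 z))
      = 1 + (if z = 1 then 1 else 0) + (if z = l then 1 else 0) := by
  have h1 : ∀ x : k, z * x = 1 * x ↔ z = 1 ∨ x = 0 := fun x => mul_eq_mul_right_iff
  have hl : ∀ x : k, z * x = l * x ↔ z = l ∨ x = 0 := fun x => mul_eq_mul_right_iff
  rw [finrank_twistedDer_of_coord _ ((if z = 1 then ∅ else {.X}) ∪ (if z = l then ∅ else {.Y}))]
  · split_ifs <;> rfl
  · intro v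
    rw [isDerValues_zChar, zero_mul, add_zero, h1, hl]
    simp only [Finset.mem_union, or_imp, forall_and]
    refine and_congr ?_ ?_ <;> split_ifs with hz <;> simp [hz]

open Classical in
theorem finrank_twistedDer_jordan (z : k) :
    finrank k (twistedDer (zChar 1 1 1 z)) = 1 + (if z = 1 then 1 else 0) := by
  have h1 : ∀ x : k, z * x = 1 * x ↔ z = 1 ∨ x = 0 := fun x => mul_eq_mul_right_iff
  rw [finrank_twistedDer_of_coord _ (if z = 1 then {.Y} else {.X, .Y})]
  · split_ifs <;> rfl
  · intro v
    rw [isDerValues_zChar, h1]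
    by_cases hz : z = 1
    · simp [hz]
    · simp only [hz, false_or, if_false, Finset.mem_insert, Finset.mem_singleton,
        forall_eq_or_imp, forall_eq]
      refine and_congr_left fun hY => ?_
      rw [hY, mul_zero, add_zero, h1]
      simp [hz]

theorem finrank_twistedDer_zero_zero_zero : finrank k (twistedDer (zChar (0 : k) 0 0 0)) = 3 := by
  rw [finrank_twistedDer_of_coord _ ∅]
  · rfl
  · intro v
    simp [isDerValues_zChar]

theorem finrank_twistedDer_zero_zero_one : finrank k (twistedDer (zChar (0 : k) 0 1 0)) = 2 := by
  rw [finrank_twistedDer_of_coord _ {.Y}]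
  · rfl
  · intro v
    simp [isDerValues_zChar, eq_comm]

/-- For a nontrivial character `χ` of `A(0, 0, 1)`, the twisted derivations are the multiples of
the inner one `χ - ε`. -/
theorem finrank_twistedDer_heisenberg_le {χ : A (0 : k) 0 1 →ₐ[k] k} (hχ : χ ≠ zChar 0 0 1 0) :
    finrank k (twistedDer χ) ≤ 1 := by
  have hY : χ (A.Y 0 0 1) = 0 := by simpa using (A.relations_of_char χ).1
  set x := χ (A.X 0 0 1) with hx
  set z := χ (A.Z 0 0 1) with hz
  have hxz : x ≠ 0 ∨ z ≠ 0 := by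
    by_contra! h
    refine hχ ?_
    ext <;> simp [hY, ← hx, ← hz, h]
  rw [finrank_twistedDer]
  let w : Gen → k := fun | .X => x | .Y => 0 | .Z => z
  have hle : LinearMap.range (derValues χ) ≤ Submodule.span k {w} := by
    intro v hv
    obtain ⟨e₁, e₂, e₃⟩ := mem_range_derValues.mp hv
    rw [← hx, hY] at e₁
    rw [← hx, ← hz] at e₂
    rw [← hz, hY] at e₃
    simp only [zero_mul, zero_add, one_mul, sub_zero, mul_eq_zero] at e₁ e₂ e₃
    have hvY : v .Y = 0 := by tauto
    rw [hvY, sub_eq_zero] at e₂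
    rw [Submodule.mem_span_singleton]
    rcases hxz with h | h
    · refine ⟨v .X / x, ?_⟩
      funext g
      cases g
      · simp [w, h]
      · simp [w, hvY]
      · simp only [w, Pi.smul_apply, smul_eq_mul]
        field_simp
        linear_combination e₂
    · refine ⟨v .Z / z, ?_⟩
      funext g
      cases g
      · simp only [w, Pi.smul_apply, smul_eq_mul]
        field_simp
        linear_combination -e₂
      · simp [w, hvY]
      · simp [w, h]
  exact (Submodule.finrank_mono hle).trans ((finrank_span_le_card _).trans (by simp))

/-! ### The isomorphism between `A(1, l, 0)` and `A(1, l⁻¹, 0)` -/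

/-- The map `A(1, l, 0) → A(1, g, 0)`, `l g = 1`, that exchanges the roles of `X` and `Y` up to
scalars `b`, `c`; it respects the comultiplication when `b c = -l`, because the element
`X Y - Z` satisfies `Δ(X Y - Z) = 1 ⊗ (X Y - Z) + Y ⊗ X + (X Y - Z) ⊗ 1`. -/
def swapAlgHom {l g : k} (b c : k) (hlg : l * g = 1) : A 1 l 0 →ₐ[k] A 1 g 0 :=
  A.lift
    (fun
      | .X => b • A.Y 1 g 0
      | .Y => c • A.X 1 g 0
      | .Z => (-l) • (A.X 1 g 0 * A.Y 1 g 0 - A.Z 1 g 0))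
    (by
      have h := sub_eq_zero.mp (A.rel_XY 1 g (0 : k))
      simp [h, mul_comm b c, smul_smul])
    (by
      have h := sub_eq_zero.mp (A.rel_XY 1 g (0 : k))
      have h' := sub_eq_iff_eq_add.mp (A.rel_ZY 1 g (0 : k))
      have e : A.X 1 g (0 : k) * A.Y 1 g 0 * A.Y 1 g 0
          = A.Y 1 g 0 * (A.X 1 g 0 * A.Y 1 g 0) := by
        rw [← mul_assoc, h]
      simp only [mul_sub, sub_mul, smul_mul_smul_comm, e, h', smul_add, smul_sub]
      have : (-l * b * g) = - b := by linear_combination -b * hlg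
      simp only [smul_smul, this, mul_comm b]
      module)
    (by
      have h := sub_eq_zero.mp (A.rel_XY 1 g (0 : k))
      have h' := sub_eq_iff_eq_add.mp (A.rel_ZX 1 g (0 : k))
      have e : A.X 1 g (0 : k) * A.Y 1 g 0 * A.X 1 g 0
          = A.X 1 g 0 * (A.X 1 g 0 * A.Y 1 g 0) := by
        rw [mul_assoc, h]
      simp only [mul_sub, sub_mul, smul_mul_smul_comm, e, h', smul_add, smul_sub]
      module)

/-- `swapAlgHom` as a map of bialgebras. -/
def swapHom {l g b c : k} (hlg : l * g = 1) (hbc : b * c = -l) : A 1 l 0 →ₐc[k] A 1 g 0 :=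
  .ofAlgHom (swapAlgHom b c hlg)
    (by ext <;> simp [swapAlgHom, A.counit_gen])
    (by
      ext
      · simp [swapAlgHom, A.comul_gen, A.comulGen, TensorProduct.smul_tmul']
      · simp [swapAlgHom, A.comul_gen, A.comulGen, TensorProduct.smul_tmul']
      · have h := sub_eq_zero.mp (A.rel_XY 1 g (0 : k))
        -- The term `X ⊗ Y` of `Δ Z` goes to `b c • Y ⊗ X`, which must match `-l • Y ⊗ X`.
        simp [swapAlgHom, A.comul_gen, A.comulGen, mul_add, add_mul, TensorProduct.tmul_neg,
          TensorProduct.neg_tmul, TensorProduct.tmul_smul, ← TensorProduct.smul_tmul',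
          TensorProduct.tmul_sub, TensorProduct.sub_tmul, h, smul_smul, mul_comm c b, hbc]
        module)

theorem swapHom_comp_swapHom {l g b c b' c' : k} (hlg : l * g = 1) (hbc : b * c = -l)
    (hgl : g * l = 1) (hbc' : b' * c' = -g) (hb : b * c' = 1) (hc : c * b' = 1) :
    (swapHom hgl hbc').comp (swapHom hlg hbc) = BialgHom.id k (A 1 l 0) := by
  have h : (swapAlgHom b' c' hgl).comp (swapAlgHom b c hlg) = AlgHom.id k (A 1 l 0) := by
    ext
    · simp [swapAlgHom, smul_smul, hb]
    · simp [swapAlgHom, smul_smul, hc]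
    · have h := sub_eq_zero.mp (A.rel_XY 1 l (0 : k))
      simp [swapAlgHom, smul_smul, mul_comm c', hbc', ← h, smul_sub, hlg]
  exact BialgHom.ext fun a => DFunLike.congr_fun h a

theorem hopfIso_swap {l g : k} (hlg : l * g = 1) : HopfIso k (A (1 : k) l 0) (A (1 : k) g 0) := by
  have hgl : g * l = 1 := by rw [mul_comm, hlg]
  have h₁ : 1 * -l = -l := one_mul _
  have h₂ : -g * 1 = -g := mul_one _
  have h₃ : -l * -g = 1 := by rw [neg_mul_neg, hlg]
  have h₄ : -g * -l = 1 := by rw [neg_mul_neg, hgl]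
  exact ⟨.ofBialgHom (swapHom hlg h₁) (swapHom hgl h₂)
    (swapHom_comp_swapHom _ _ _ _ h₄ (one_mul 1)) (swapHom_comp_swapHom _ _ _ _ (one_mul 1) h₃)⟩

/-! ### Classification -/

/-- The dimension at the counit is an invariant. -/
theorem finrank_twistedDer_zero_eq_of_hopfIso {m₁ m₂ β : k}
    (h : HopfIso k (A l₁ l₂ α) (A m₁ m₂ β)) :
    finrank k (twistedDer (zChar l₁ l₂ α 0)) = finrank k (twistedDer (zChar m₁ m₂ β 0)) := by
  obtain ⟨e⟩ := h
  rw [← finrank_twistedDer_comp e, zChar_zero_comp]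

theorem exists_finrank_twistedDer_eq [Infinite k] {m₁ m₂ β : k} (h₁ : l₁ ≠ 0) (h₂ : l₂ ≠ 0)
    (h₃ : m₁ ≠ 0) (h₄ : m₂ ≠ 0) (h : HopfIso k (A l₁ l₂ α) (A m₁ m₂ β)) :
    ∃ c : k, c ≠ 0 ∧ ∀ z, finrank k (twistedDer (zChar l₁ l₂ α (c * z)))
      = finrank k (twistedDer (zChar m₁ m₂ β z)) := by
  obtain ⟨e⟩ := h
  obtain ⟨c, hc, he⟩ := exists_zChar_comp_eq h₁ h₂ h₃ h₄ e
  exact ⟨c, hc, fun z => by rw [← he, finrank_twistedDer_comp]⟩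

theorem not_hopfIso_heisenberg_diag (l : k) : ¬ HopfIso k (A (0 : k) 0 1) (A (1 : k) l 0) := by
  intro h
  have h0 := finrank_twistedDer_zero_eq_of_hopfIso h
  rw [finrank_twistedDer_zero_zero_one, finrank_twistedDer_diag] at h0
  have hl : l = 0 := by
    by_contra hl
    simp [Ne.symm hl] at h0
  subst hl
  obtain ⟨e⟩ := h
  -- The character `Z ↦ 1` of `A(1, 0, 0)` has a two-dimensional space of twisted derivations.
  have h1 := finrank_twistedDer_comp e (zChar 1 0 0 1)
  have hne : (zChar 1 0 0 1).comp (e : A (0 : k) 0 1 →ₐ[k] A (1 : k) 0 0) ≠ zChar 0 0 1 0 := by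
    rw [← zChar_zero_comp e]
    intro h
    have h' := DFunLike.congr_fun h (e.symm (A.Z 1 0 0))
    change zChar 1 0 0 1 (e (e.symm _)) = zChar 1 0 0 0 (e (e.symm _)) at h'
    simp at h'
  have h2 := finrank_twistedDer_heisenberg_le hne
  rw [h1, finrank_twistedDer_diag] at h2
  simp at h2

theorem not_hopfIso_jordan_diag [Infinite k] (l : k) :
    ¬ HopfIso k (A (1 : k) 1 1) (A (1 : k) l 0) := by
  intro h
  have h0 := finrank_twistedDer_zero_eq_of_hopfIso h
  rw [finrank_twistedDer_jordan, finrank_twistedDer_diag] at h0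
  have hl : l ≠ 0 := by
    rintro rfl
    simp at h0
  obtain ⟨c, -, h⟩ := exists_finrank_twistedDer_eq one_ne_zero one_ne_zero one_ne_zero hl h
  simp only [finrank_twistedDer_jordan, finrank_twistedDer_diag] at h
  have h1 := h 1
  have h2 := h l
  grind

theorem eq_or_mul_eq_one_of_hopfIso [Infinite k] {l g : k}
    (h : HopfIso k (A (1 : k) l 0) (A (1 : k) g 0)) : l = g ∨ l * g = 1 := by
  have h0 := finrank_twistedDer_zero_eq_of_hopfIso h
  rw [finrank_twistedDer_diag, finrank_twistedDer_diag] at h0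
  by_cases hl : l = 0
  · grind
  have hg : g ≠ 0 := by grind
  obtain ⟨c, hc, h⟩ := exists_finrank_twistedDer_eq one_ne_zero hl one_ne_zero hg h
  simp only [finrank_twistedDer_diag] at h
  -- Multiplication by `c` carries the multiset `{1, g}` to the multiset `{1, l}`.
  have h1 := h 1
  have h2 := h g
  grind

end ConnHopf

end

theorem mainTheorem9 {k : Type*} [Field k] [IsAlgClosed k] [CharZero k] :
    (∀ l : k,
      ¬ HopfIso k (ConnHopf.A (0 : k) 0 0) (ConnHopf.A (0 : k) 0 1) ∧
      ¬ HopfIso k (ConnHopf.A (0 : k) 0 0) (ConnHopf.A (1 : k) 1 1) ∧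
      ¬ HopfIso k (ConnHopf.A (0 : k) 0 0) (ConnHopf.A (1 : k) l 0) ∧
      ¬ HopfIso k (ConnHopf.A (0 : k) 0 1) (ConnHopf.A (1 : k) 1 1) ∧
      ¬ HopfIso k (ConnHopf.A (0 : k) 0 1) (ConnHopf.A (1 : k) l 0) ∧
      ¬ HopfIso k (ConnHopf.A (1 : k) 1 1) (ConnHopf.A (1 : k) l 0)) ∧
    (∀ l g : k,
      HopfIso k (ConnHopf.A (1 : k) l 0) (ConnHopf.A (1 : k) g 0) ↔ l = g ∨ l * g = 1) := by
  open ConnHopf in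
  have : Infinite k := IsAlgClosed.instInfinite
  refine ⟨fun l => ⟨fun h => ?_, fun h => ?_, fun h => ?_, fun h => ?_,
    not_hopfIso_heisenberg_diag l, not_hopfIso_jordan_diag l⟩,
    fun l g => ⟨eq_or_mul_eq_one_of_hopfIso, ?_⟩⟩
  · have h0 := finrank_twistedDer_zero_eq_of_hopfIso h
    simp [finrank_twistedDer_zero_zero_zero, finrank_twistedDer_zero_zero_one] at h0
  · have h0 := finrank_twistedDer_zero_eq_of_hopfIso h
    simp [finrank_twistedDer_zero_zero_zero, finrank_twistedDer_jordan] at h0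
  · have h0 := finrank_twistedDer_zero_eq_of_hopfIso h
    rw [finrank_twistedDer_zero_zero_zero, finrank_twistedDer_diag] at h0
    grind
  · have h0 := finrank_twistedDer_zero_eq_of_hopfIso h
    simp [finrank_twistedDer_zero_zero_one, finrank_twistedDer_jordan] at h0
  · rintro (rfl | h)
    · exact ⟨.refl k _⟩
    · exact hopfIso_swap h
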